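/- A polynomial automorphism of $\mathbb{C}^2$ is a polynomial mapping $F=(F_1,F_2):\mathbb{C}^2\to\mathbb{C}^2$ that has an inverse $F^{-1}$ which is also a polynomial mapping; $\operatorname{Aut}(\mathbb{C}^2)$ denotes the group of all of them. Its multidegree is $\operatorname{mdeg}F=(\deg F_1,\deg F_2)$, where $\deg$ is the total degree, and $F$ is called affine if $\operatorname{mdeg}F=(1,1)$. Every $F\in\operatorname{Aut}(\mathbb{C}^2)$ can be written as $$F=L_2\circ T_l\circ\cdots\circ T_1\circ L_1,$$ where $l\ge 0$, $L_1,L_2$ are affine automorphisms, $T_i(x,y)=(x,y+f_i(x))$ for odd $i$, $T_i(x,y)=(x+f_i(y),y)$ for even $i$, and $f_i\in\mathbb{C}[T]$ with $\deg f_i>1$ for $i=1,\dots,l$. The number $l$ depends only on $F$; it is called the length of $F$ and denoted $\operatorname{length}F$. For a positive integer $k$ let $l(k)$ be the number of prime factors of $k$ counted with multiplicity. **Theorem.** Let $F\in\operatorname{Aut}(\mathbb{C}^2)$ satisfy $\operatorname{length}F\ge 3$ and $\operatorname{mdeg}F=(d_1,d_2)$ with $1<d_1<d_2$ and $d_1\mid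 d_2$. Then $$\operatorname{mdeg}F^{-1}\in\left\{\left(d_2,\tfrac{d_2}{a}\right),\left(\tfrac{d_2}{a},d_2\right),(d_2,d_2)\;:\;a\in\mathcal{A}_F\right\},$$ where $\mathcal{A}_F=\left\{a\in\mathbb{N}:1<a<d_1,\ a\mid d_1,\ l\!\left(\tfrac{d_1}{a}\right)\ge\operatorname{length}F-2\right\}$. (In particular $\mathcal{A}_F$ is nonempty.) -/

import Mathlib

/-- A polynomial mapping `ℂⁿ → ℂⁿ`, given by its coordinate polynomials `(F₁, …, Fₙ)`. -/
abbrev PolyMap (n : ℕ) : Type := Fin n → MvPolynomial (Fin n) ℂ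

namespace PolyMap

/-- The underlying mapping of the space `ℂⁿ` into itself. -/
noncomputable def toFun {n : ℕ} (F : PolyMap n) (x : Fin n → ℂ) : Fin n → ℂ :=
  fun i => MvPolynomial.eval x (F i)

/-- The composition `F ∘ G`: substitute the coordinates of `G` into those of `F`. -/
noncomputable def comp {n : ℕ} (F G : PolyMap n) : PolyMap n :=
  fun i => MvPolynomial.bind₁ G (F i)

theorem toFun_comp {n : ℕ} (F G : PolyMap n) (x : Fin n → ℂ) :
    (F.comp G).toFun x = F.toFun (G.toFun x) := by
  funext i
  simp only [toFun, comp, MvPolynomial.eval, MvPolynomial.eval₂Hom_bind₁]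
  rfl

theorem toFun_X {n : ℕ} (x : Fin n → ℂ) :
    PolyMap.toFun (MvPolynomial.X : PolyMap n) x = x := by
  funext i
  simp [toFun]

theorem ext_toFun {n : ℕ} {F G : PolyMap n} (h : ∀ x, F.toFun x = G.toFun x) : F = G := by
  funext i
  exact MvPolynomial.funext fun x => congrFun (h x) i

theorem eval_aeval_X {n : ℕ} (x : Fin n → ℂ) (i : Fin n) (f : Polynomial ℂ) :
    MvPolynomial.eval x (Polynomial.aeval (MvPolynomial.X i) f) = f.eval (x i) := by
  induction f using Polynomial.induction_on' with
  | add p q hp hq => simp [hp, hq]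
  | monomial k c => simp [Polynomial.aeval_monomial]

end PolyMap

/-- A polynomial automorphism of `ℂⁿ`: a polynomial mapping `F` together with its inverse,
a polynomial mapping `G` with `G ∘ F = F ∘ G = id` as mappings of `ℂⁿ`. -/
structure PolyAut (n : ℕ) where
  /-- the coordinate polynomials of the automorphism -/
  map : PolyMap n
  /-- the coordinate polynomials of the inverse -/
  inv : PolyMap n
  inv_map : ∀ x : Fin n → ℂ, inv.toFun (map.toFun x) = x
  map_inv : ∀ x : Fin n → ℂ, map.toFun (inv.toFun x) = x

namespace PolyAut

/-- An automorphism is determined by its coordinate polynomials. -/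
theorem ext_map {n : ℕ} {F G : PolyAut n} (h : F.map = G.map) : F = G := by
  have hi : F.inv = G.inv := by
    apply PolyMap.ext_toFun
    intro x
    have h1 := F.inv_map (G.inv.toFun x)
    rw [h, G.map_inv x] at h1
    exact h1
  cases F
  cases G
  cases h
  cases hi
  rfl

/-- The group `Aut(ℂⁿ)`: `F * G` is the composition `F ∘ G`, and `F⁻¹` is the inverse mapping. -/
noncomputable instance instGroup (n : ℕ) : Group (PolyAut n) where
  mul F G :=
    { map := F.map.comp G.map
      inv := G.inv.comp F.inv
      inv_map := fun x => by
        rw [PolyMap.toFun_comp, PolyMap.toFun_comp, F.inv_map, G.inv_map]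
      map_inv := fun x => by
        rw [PolyMap.toFun_comp, PolyMap.toFun_comp, G.map_inv, F.map_inv] }
  one :=
    { map := MvPolynomial.X
      inv := MvPolynomial.X
      inv_map := fun x => by rw [PolyMap.toFun_X, PolyMap.toFun_X]
      map_inv := fun x => by rw [PolyMap.toFun_X, PolyMap.toFun_X] }
  inv F :=
    { map := F.inv
      inv := F.map
      inv_map := F.map_inv
      map_inv := F.inv_map }
  mul_assoc F G H := ext_map <| PolyMap.ext_toFun fun x => by
    change ((F.map.comp G.map).comp H.map).toFun x = (F.map.comp (G.map.comp H.map)).toFun x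
    simp only [PolyMap.toFun_comp]
  one_mul F := ext_map <| PolyMap.ext_toFun fun x => by
    change (PolyMap.comp MvPolynomial.X F.map).toFun x = F.map.toFun x
    rw [PolyMap.toFun_comp, PolyMap.toFun_X]
  mul_one F := ext_map <| PolyMap.ext_toFun fun x => by
    change (PolyMap.comp F.map MvPolynomial.X).toFun x = F.map.toFun x
    rw [PolyMap.toFun_comp, PolyMap.toFun_X]
  inv_mul_cancel F := ext_map <| PolyMap.ext_toFun fun x => by
    change (F.inv.comp F.map).toFun x = PolyMap.toFun MvPolynomial.X x
    rw [PolyMap.toFun_comp, PolyMap.toFun_X, F.inv_map]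

/-- The multidegree `mdeg F = (deg F₁, …, deg Fₙ)`, with the total degree. -/
noncomputable def mdeg {n : ℕ} (F : PolyAut n) : Fin n → ℕ :=
  fun i => (F.map i).totalDegree

/-- Affine automorphisms: all the coordinates have degree one. -/
def IsAffine {n : ℕ} (F : PolyAut n) : Prop :=
  ∀ i, (F.map i).totalDegree = 1

/-- The triangular automorphism `(x, y) ↦ (x, y + f(x))` of `ℂ²`. -/
noncomputable def shearY (f : Polynomial ℂ) : PolyAut 2 where
  map := ![MvPolynomial.X 0, MvPolynomial.X 1 + Polynomial.aeval (MvPolynomial.X 0) f]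
  inv := ![MvPolynomial.X 0, MvPolynomial.X 1 - Polynomial.aeval (MvPolynomial.X 0) f]
  inv_map x := by
    funext i
    fin_cases i <;> simp [PolyMap.toFun, PolyMap.eval_aeval_X]
  map_inv x := by
    funext i
    fin_cases i <;> simp [PolyMap.toFun, PolyMap.eval_aeval_X]

/-- The triangular automorphism `(x, y) ↦ (x + f(y), y)` of `ℂ²`. -/
noncomputable def shearX (f : Polynomial ℂ) : PolyAut 2 where
  map := ![MvPolynomial.X 0 + Polynomial.aeval (MvPolynomial.X 1) f, MvPolynomial.X 1]
  inv := ![MvPolynomial.X 0 - Polynomial.aeval (MvPolynomial.X 1) f, MvPolynomial.X 1]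
  inv_map x := by
    funext i
    fin_cases i <;> simp [PolyMap.toFun, PolyMap.eval_aeval_X]
  map_inv x := by
    funext i
    fin_cases i <;> simp [PolyMap.toFun, PolyMap.eval_aeval_X]

/-- The triangular automorphism `Tᵢ` defined by `f`:
`(x, y) ↦ (x, y + f(x))` for odd `i` and `(x, y) ↦ (x + f(y), y)` for even `i`. -/
noncomputable def triangular (i : ℕ) (f : Polynomial ℂ) : PolyAut 2 :=
  if Odd i then shearY f else shearX f

/-- The composition `T_l ∘ ⋯ ∘ T₁`, where `Tᵢ` is defined by `f i`. -/
noncomputable def triangularComp (f : ℕ → Polynomial ℂ) : ℕ → PolyAut 2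
  | 0 => 1
  | l + 1 => triangular (l + 1) (f (l + 1)) * triangularComp f l

/-- `F = L₂ ∘ T_l ∘ ⋯ ∘ T₁ ∘ L₁` with affine `L₁`, `L₂` and alternating triangular `Tᵢ`
defined by polynomials `fᵢ` of degree greater than one. -/
def HasDecomposition (F : PolyAut 2) (l : ℕ) : Prop :=
  ∃ (L₁ L₂ : PolyAut 2) (f : ℕ → Polynomial ℂ), L₁.IsAffine ∧ L₂.IsAffine ∧
    (∀ i, 1 ≤ i → i ≤ l → 1 < (f i).natDegree) ∧
    F = L₂ * triangularComp f l * L₁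

/-- The length of an automorphism of `ℂ²`: the number of triangular factors in a decomposition
`F = L₂ ∘ T_l ∘ ⋯ ∘ T₁ ∘ L₁` as above. (Every automorphism of `ℂ²` has such a decomposition,
and `l` is the same for all of them; the infimum names this number.) -/
noncomputable def length (F : PolyAut 2) : ℕ :=
  sInf {l : ℕ | F.HasDecomposition l}

end PolyAut

namespace PolyAut

open MvPolynomial

/-! Write `F = L₂ ∘ T_l ∘ ⋯ ∘ T₁ ∘ L₁` with `n_i = deg f_i`. Each shear replaces the smaller degree
by `n_i` times the larger, as no leading terms can cancel. So `T_l ∘ ⋯ ∘ T₁ ∘ L₁` has degrees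
`n₁⋯n_{l-1}` and `n₁⋯n_l` (`mdeg_triangularComp_mul`). An affine map on the left can only permute
two distinct degrees or duplicate the larger (`IsAffine.mdeg_mul`), so `d₁ < d₂` identifies `d₁` and
`d₂` with these products. The inverse uses the same `n_i` in the opposite order, giving `n₂⋯n_l` and
`n₁⋯n_l` before `L₁⁻¹` is applied (`mdeg_inv_triangularComp_mul`). Hence `a = n₁` works: `d₂ / a =
n₂⋯n_l`, and `d₁ / a = n₂⋯n_{l-1}` is a product of `l - 2` factors greater than one. -/

/-! ### Total degrees of products and substitutions -/

theorem totalDegree_pow_of_isDomain {σ R : Type*} [CommRing R] [IsDomain R]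
    {p : MvPolynomial σ R} (hp : p ≠ 0) (n : ℕ) :
    (p ^ n).totalDegree = n * p.totalDegree := by
  induction n with
  | zero => simp
  | succ n ih => rw [pow_succ, totalDegree_mul_of_isDomain (pow_ne_zero n hp) hp, ih]; ring

theorem totalDegree_C_mul_of_ne_zero {σ R : Type*} [CommRing R] [IsDomain R]
    {a : R} (ha : a ≠ 0) (p : MvPolynomial σ R) :
    (C a * p).totalDegree = p.totalDegree := by
  by_cases hp : p = 0
  · simp [hp]
  · rw [totalDegree_mul_of_isDomain ((C_ne_zero).2 ha) hp, totalDegree_C, zero_add]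

theorem totalDegree_C_mul_le {σ R : Type*} [CommRing R] (a : R) (p : MvPolynomial σ R) :
    (C a * p).totalDegree ≤ p.totalDegree :=
  (totalDegree_mul _ _).trans (by simp)

theorem totalDegree_polynomial_aeval_le {σ R : Type*} [CommRing R] (p : MvPolynomial σ R)
    (f : Polynomial R) :
    (Polynomial.aeval p f).totalDegree ≤ f.natDegree * p.totalDegree := by
  rw [Polynomial.aeval_eq_sum_range]
  refine totalDegree_finsetSum_le fun i hi => ?_
  refine (totalDegree_smul_le _ _).trans ((totalDegree_pow _ _).trans ?_)
  exact Nat.mul_le_mul_right _ (Nat.lt_succ_iff.1 (Finset.mem_range.1 hi))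

/-- Since `p` is nonconstant, the leading term of `f` at `p` strictly dominates the remaining ones.
-/
theorem totalDegree_polynomial_aeval {σ R : Type*} [CommRing R] [IsDomain R]
    {p : MvPolynomial σ R} (hp : 0 < p.totalDegree) {f : Polynomial R} (hf : 0 < f.natDegree) :
    (Polynomial.aeval p f).totalDegree = f.natDegree * p.totalDegree := by
  have hp0 : p ≠ 0 := by rintro rfl; simp at hp
  have hf0 : f.leadingCoeff ≠ 0 := by
    rw [Ne, Polynomial.leadingCoeff_eq_zero]; rintro rfl; simp at hf
  have hlead : (C f.leadingCoeff * p ^ f.natDegree).totalDegree =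
      f.natDegree * p.totalDegree := by
    rw [totalDegree_C_mul_of_ne_zero hf0, totalDegree_pow_of_isDomain hp0]
  have hsplit : Polynomial.aeval p f =
      C f.leadingCoeff * p ^ f.natDegree + Polynomial.aeval p f.eraseLead := by
    have h := congrArg (Polynomial.aeval p) f.eraseLead_add_C_mul_X_pow
    rw [map_add, map_mul, map_pow, Polynomial.aeval_C, Polynomial.aeval_X, add_comm] at h
    exact h.symm
  rw [hsplit, totalDegree_add_eq_left_of_totalDegree_lt, hlead]
  rw [hlead]
  refine (totalDegree_polynomial_aeval_le _ _).trans_lt ?_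
  refine Nat.mul_lt_mul_of_pos_right ?_ hp
  exact (f.eraseLead_natDegree_le).trans_lt (by lia)

theorem totalDegree_add_polynomial_aeval {σ R : Type*} [CommRing R] [IsDomain R]
    {p q : MvPolynomial σ R} (hp : 0 < p.totalDegree) (hq : q.totalDegree ≤ p.totalDegree)
    {f : Polynomial R} (hf : 1 < f.natDegree) :
    (q + Polynomial.aeval p f).totalDegree = f.natDegree * p.totalDegree := by
  have h := totalDegree_polynomial_aeval hp (f := f) (by lia)
  rw [totalDegree_add_eq_right_of_totalDegree_lt, h]
  rw [h]
  exact hq.trans_lt (by nlinarith)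

theorem eq_linear_of_totalDegree_le_one {R : Type*} [CommRing R] {p : MvPolynomial (Fin 2) R}
    (hp : p.totalDegree ≤ 1) : ∃ a b c : R, p = C a * X 0 + C b * X 1 + C c := by
  refine ⟨coeff (Finsupp.single 0 1) p, coeff (Finsupp.single 1 1) p, coeff 0 p, ?_⟩
  have hsub : p.support ⊆ {Finsupp.single 0 1, Finsupp.single 1 1, 0} := by
    intro d hd
    have h := (le_totalDegree hd).trans hp
    rw [Finsupp.sum_fintype _ _ (fun _ => rfl), Fin.sum_univ_two] at h
    have key : (d 0 = 1 ∧ d 1 = 0) ∨ (d 0 = 0 ∧ d 1 = 1) ∨ (d 0 = 0 ∧ d 1 = 0) := by lia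
    simp only [Finset.mem_insert, Finset.mem_singleton]
    rcases key with h | h | h
    · left; ext i; fin_cases i <;> simp [h.1, h.2]
    · right; left; ext i; fin_cases i <;> simp [h.1, h.2]
    · right; right; ext i; fin_cases i <;> simp [h.1, h.2]
  have h0 : (Finsupp.single (0 : Fin 2) 1 : Fin 2 →₀ ℕ) ≠ Finsupp.single 1 1 := by
    intro h; simpa using DFunLike.congr_fun h 0
  conv_lhs => rw [p.as_sum]
  rw [Finset.sum_subset hsub fun d _ hd => by rw [notMem_support_iff.1 hd, monomial_zero],
    Finset.sum_insert (by simp [h0]), Finset.sum_insert (by simp), Finset.sum_singleton,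
    ← add_assoc]
  simp [C_mul_X_eq_monomial]

/-! ### Affine automorphisms and their effect on degrees -/

theorem map_mul (F G : PolyAut 2) (i : Fin 2) : (F * G).map i = bind₁ G.map (F.map i) := rfl

theorem map_injective {n : ℕ} (F : PolyAut n) : Function.Injective F.map.toFun :=
  Function.LeftInverse.injective F.inv_map

/-- By surjectivity, a constant coordinate would force the `i`-th coordinate to agree at all points.
-/
theorem totalDegree_map_pos (F : PolyAut 2) (i : Fin 2) : 0 < (F.map i).totalDegree := by
  by_contra h
  have h0 := totalDegree_eq_zero_iff_eq_C.1 (Nat.eq_zero_of_not_pos h)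
  have key (x : Fin 2 → ℂ) : x i = coeff 0 (F.map i) := by
    have := congrFun (F.map_inv x) i
    rw [← this, PolyMap.toFun, h0]
    simp
  have h1 := (key 0).trans (key 1).symm
  simp at h1

theorem IsAffine.exists_eq_linear {L : PolyAut 2} (hL : L.IsAffine) :
    ∃ a b c a' b' c' : ℂ, L.map 0 = C a * X 0 + C b * X 1 + C c ∧
      L.map 1 = C a' * X 0 + C b' * X 1 + C c' ∧ a * b' - b * a' ≠ 0 := by
  obtain ⟨a, b, c, h0⟩ := eq_linear_of_totalDegree_le_one (hL 0).le
  obtain ⟨a', b', c', h1⟩ := eq_linear_of_totalDegree_le_one (hL 1).le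
  refine ⟨a, b, c, a', b', c', h0, h1, fun hdet => ?_⟩
  have hval (u v : ℂ) (hu : a * u + b * v = 0) (hv : a' * u + b' * v = 0) : u = 0 ∧ v = 0 := by
    have : (![u, v] : Fin 2 → ℂ) = 0 := L.map_injective <| by
      funext i
      fin_cases i <;> simp [PolyMap.toFun, h0, h1, hu, hv]
    exact ⟨by simpa using congrFun this 0, by simpa using congrFun this 1⟩
  -- If the determinant vanishes, the columns of the adjugate lie in the kernel, which is trivial by
  -- injectivity; so all entries are zero and `(1, 0)` is in the kernel too.
  have e1 := hval b' (-a') (by linear_combination hdet) (by ring)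
  have e2 := hval (-b) a (by ring) (by linear_combination hdet)
  have e3 := hval 1 0 (by simp [e2.2]) (by simpa using e1.2)
  simp at e3

theorem totalDegree_linear_le (a b c : ℂ) {p q : MvPolynomial (Fin 2) ℂ} {d : ℕ}
    (hp : p.totalDegree ≤ d) (hq : q.totalDegree ≤ d) :
    (C a * p + C b * q + C c).totalDegree ≤ d := by
  refine (totalDegree_add _ _).trans (max_le ((totalDegree_add _ _).trans (max_le ?_ ?_)) ?_)
  · exact (totalDegree_C_mul_le _ _).trans hp
  · exact (totalDegree_C_mul_le _ _).trans hq
  · simp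

theorem totalDegree_linear_eq {a : ℂ} (ha : a ≠ 0) (b c : ℂ) {p q : MvPolynomial (Fin 2) ℂ}
    (h : q.totalDegree < p.totalDegree) :
    (C a * p + C b * q + C c).totalDegree = p.totalDegree := by
  have hp := totalDegree_C_mul_of_ne_zero ha p
  rw [add_assoc, totalDegree_add_eq_left_of_totalDegree_lt, hp]
  rw [hp]
  refine (totalDegree_add _ _).trans_lt (max_lt ((totalDegree_C_mul_le _ _).trans_lt h) ?_)
  rw [totalDegree_C]
  lia

theorem IsAffine.inv {L : PolyAut 2} (hL : L.IsAffine) : L⁻¹.IsAffine := by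
  obtain ⟨a, b, c, a', b', c', h0, h1, hdet⟩ := hL.exists_eq_linear
  set e := (a * b' - b * a')⁻¹ with he
  -- Cramer's rule.
  have hmap : L⁻¹.map = ![C (e * b') * X 0 + C (-(e * b)) * X 1 + C (e * (b * c' - b' * c)),
      C (-(e * a')) * X 0 + C (e * a) * X 1 + C (e * (a' * c - a * c'))] := by
    refine PolyMap.ext_toFun fun y => ?_
    rw [← L.map_inv y]
    have hinv : L⁻¹.map.toFun (L.map.toFun (L.inv.toFun y)) = L.inv.toFun y := L.inv_map _
    rw [hinv]
    generalize L.inv.toFun y = x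
    have hdet' : e * (a * b' - b * a') = 1 := inv_mul_cancel₀ hdet
    funext i
    fin_cases i
    · simp [PolyMap.toFun, h0, h1]
      linear_combination -(x 0) * hdet'
    · simp [PolyMap.toFun, h0, h1]
      linear_combination -(x 1) * hdet'
  intro i
  refine le_antisymm ?_ (totalDegree_map_pos _ i)
  rw [hmap]
  fin_cases i <;> exact totalDegree_linear_le _ _ _ (by simp) (by simp)

theorem totalDegree_linear_mem (a b c : ℂ) {p q : MvPolynomial (Fin 2) ℂ}
    (hq : 0 < q.totalDegree) (hqp : q.totalDegree < p.totalDegree)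
    (h : 0 < (C a * p + C b * q + C c).totalDegree) :
    (C a * p + C b * q + C c).totalDegree = if a = 0 then q.totalDegree else p.totalDegree := by
  split_ifs with ha
  · subst ha
    have hb : b ≠ 0 := by rintro rfl; simp at h
    have := totalDegree_linear_eq hb 0 c (p := q) (q := C 0) (by simpa using hq)
    simpa using this
  · exact totalDegree_linear_eq ha b c hqp

theorem mdeg_eq_iff {F : PolyAut 2} {m n : ℕ} :
    F.mdeg = ![m, n] ↔ (F.map 0).totalDegree = m ∧ (F.map 1).totalDegree = n := by
  simp [funext_iff, Fin.forall_fin_two, mdeg]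

/-- Composing with an affine automorphism on the left changes two distinct degrees `m < M` of the
coordinates into `(m, M)`, `(M, m)` or `(M, M)`. -/
theorem IsAffine.mdeg_mul {L G : PolyAut 2} (hL : L.IsAffine) {m M : ℕ} (hmM : m < M)
    (hG : G.mdeg = ![m, M] ∨ G.mdeg = ![M, m]) :
    (L * G).mdeg = ![m, M] ∨ (L * G).mdeg = ![M, m] ∨ (L * G).mdeg = ![M, M] := by
  obtain ⟨a, b, c, a', b', c', h0, h1, hdet⟩ := hL.exists_eq_linear
  have e0 : (L * G).map 0 = C a * G.map 0 + C b * G.map 1 + C c := by simp [map_mul, h0]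
  have e1 : (L * G).map 1 = C a' * G.map 0 + C b' * G.map 1 + C c' := by simp [map_mul, h1]
  have p0 := (L * G).totalDegree_map_pos 0
  have p1 := (L * G).totalDegree_map_pos 1
  have g0 := G.totalDegree_map_pos 0
  have g1 := G.totalDegree_map_pos 1
  simp only [mdeg_eq_iff] at hG ⊢
  rcases hG with ⟨hx, hy⟩ | ⟨hx, hy⟩
  · rw [add_comm (C a * G.map 0)] at e0
    rw [add_comm (C a' * G.map 0)] at e1
    rw [e0] at p0 ⊢
    rw [e1] at p1 ⊢
    rw [totalDegree_linear_mem _ _ _ g0 (by lia) p0, totalDegree_linear_mem _ _ _ g0 (by lia) p1,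
      hx, hy]
    -- The determinant excludes `(m, m)`: the coordinate of degree `M` cannot be absent from both
    -- rows.
    have : ¬(b = 0 ∧ b' = 0) := by rintro ⟨rfl, rfl⟩; simp at hdet
    split_ifs <;> simp_all
  · rw [e0] at p0 ⊢
    rw [e1] at p1 ⊢
    rw [totalDegree_linear_mem _ _ _ g1 (by lia) p0, totalDegree_linear_mem _ _ _ g1 (by lia) p1,
      hx, hy]
    have : ¬(a = 0 ∧ a' = 0) := by rintro ⟨rfl, rfl⟩; simp at hdet
    split_ifs <;> simp_all

/-! ### Shears and their alternating compositions -/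

theorem mdeg_shearY_mul {f : Polynomial ℂ} (hf : 1 < f.natDegree) {G : PolyAut 2} {m n : ℕ}
    (hnm : n ≤ m) (hG : G.mdeg = ![m, n]) : (shearY f * G).mdeg = ![m, f.natDegree * m] := by
  have g0 := G.totalDegree_map_pos 0
  rw [mdeg_eq_iff] at hG ⊢
  obtain ⟨rfl, rfl⟩ := hG
  refine ⟨by simp [map_mul, shearY], ?_⟩
  have e : (shearY f * G).map 1 = G.map 1 + Polynomial.aeval (G.map 0) f := by
    simp [map_mul, shearY, ← Polynomial.aeval_algHom_apply]
  rw [e, totalDegree_add_polynomial_aeval g0 hnm hf]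

theorem mdeg_shearX_mul {f : Polynomial ℂ} (hf : 1 < f.natDegree) {G : PolyAut 2} {m n : ℕ}
    (hmn : m ≤ n) (hG : G.mdeg = ![m, n]) : (shearX f * G).mdeg = ![f.natDegree * n, n] := by
  have g1 := G.totalDegree_map_pos 1
  rw [mdeg_eq_iff] at hG ⊢
  obtain ⟨rfl, rfl⟩ := hG
  refine ⟨?_, by simp [map_mul, shearX]⟩
  have e : (shearX f * G).map 0 = G.map 0 + Polynomial.aeval (G.map 1) f := by
    simp [map_mul, shearX, ← Polynomial.aeval_algHom_apply]
  rw [e, totalDegree_add_polynomial_aeval g1 hmn hf]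

theorem inv_triangular (i : ℕ) (f : Polynomial ℂ) : (triangular i f)⁻¹ = triangular i (-f) := by
  apply ext_map
  change (triangular i f).inv = _
  unfold triangular
  split_ifs <;> funext j <;> fin_cases j <;> simp [shearX, shearY, sub_eq_add_neg]

theorem mdeg_triangularComp_mul {f : ℕ → Polynomial ℂ} {k : ℕ}
    (hf : ∀ i, 1 ≤ i → i ≤ k + 1 → 1 < (f i).natDegree) {G : PolyAut 2} (hG : G.IsAffine) :
    (triangularComp f (k + 1) * G).mdeg = if Odd (k + 1)
      then ![∏ i ∈ Finset.range k, (f (i + 1)).natDegree,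
        ∏ i ∈ Finset.range (k + 1), (f (i + 1)).natDegree]
      else ![∏ i ∈ Finset.range (k + 1), (f (i + 1)).natDegree,
        ∏ i ∈ Finset.range k, (f (i + 1)).natDegree] := by
  induction k with
  | zero =>
    have h := mdeg_shearY_mul (hf 1 le_rfl le_rfl) le_rfl (mdeg_eq_iff.2 ⟨hG 0, hG 1⟩)
    simpa [triangularComp, triangular] using h
  | succ k ih =>
    have ih := ih fun i h1 h2 => hf i h1 (by lia)
    have hk := hf (k + 1 + 1) (by lia) le_rfl
    have hle : ∏ i ∈ Finset.range k, (f (i + 1)).natDegree ≤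
        ∏ i ∈ Finset.range (k + 1), (f (i + 1)).natDegree := by
      rw [Finset.prod_range_succ]
      exact Nat.le_mul_of_pos_right _ (by have := hf (k + 1) (by lia) (by lia); lia)
    rw [triangularComp, mul_assoc, triangular, Finset.prod_range_succ _ (k + 1), mul_comm (∏ i ∈ _, _)]
    by_cases h : Odd (k + 1)
    · have h' : ¬ Odd (k + 1 + 1) := by grind
      rw [if_pos h] at ih
      rw [if_neg h', if_neg h']
      exact mdeg_shearX_mul hk hle ih
    · have h' : Odd (k + 1 + 1) := by grind
      rw [if_neg h] at ih
      rw [if_pos h', if_pos h']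
      exact mdeg_shearY_mul hk hle ih

/-- The factor with the highest index acts first, and the parity condition puts the larger degree
`m` in the variable it substitutes. The order of the result is free of parity because `T₁⁻¹` acts
last. -/
theorem mdeg_inv_triangularComp_mul {f : ℕ → Polynomial ℂ} {k : ℕ}
    (hf : ∀ i, 1 ≤ i → i ≤ k + 1 → 1 < (f i).natDegree) {G : PolyAut 2} {m n : ℕ} (hnm : n ≤ m)
    (hG : G.mdeg = if Odd (k + 1) then ![m, n] else ![n, m]) :
    ((triangularComp f (k + 1))⁻¹ * G).mdeg =
      ![m * ∏ i ∈ Finset.range k, (f (i + 2)).natDegree,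
        m * ∏ i ∈ Finset.range (k + 1), (f (i + 1)).natDegree] := by
  induction k generalizing G m n with
  | zero =>
    have hf1 : 1 < (-f 1).natDegree := by simpa using hf 1 le_rfl le_rfl
    have h := mdeg_shearY_mul hf1 hnm (by simpa using hG)
    have e : triangularComp f (0 + 1) = triangular 1 (f 1) := mul_one _
    rw [e, inv_triangular]
    simpa [triangular, mul_comm] using h
  | succ k ih =>
    have hk : 1 < (-f (k + 1 + 1)).natDegree := by simpa using hf (k + 1 + 1) (by lia) le_rfl
    have hle : m ≤ (-f (k + 1 + 1)).natDegree * m := Nat.le_mul_of_pos_left _ (by lia)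
    rw [triangularComp, mul_inv_rev, mul_assoc, inv_triangular]
    rw [ih (fun i h1 h2 => hf i h1 (by lia)) hle (G := triangular (k + 1 + 1) (-f (k + 1 + 1)) * G)]
    · rw [Polynomial.natDegree_neg, Finset.prod_range_succ (fun i => (f (i + 2)).natDegree) k,
        Finset.prod_range_succ (fun i => (f (i + 1)).natDegree) (k + 1)]
      congr 1
      · ring
      · congr 1; ring
    · unfold triangular
      by_cases h : Odd (k + 1)
      · have h' : ¬ Odd (k + 1 + 1) := by grind
        rw [if_neg h'] at hG ⊢
        rw [if_pos h]
        exact mdeg_shearX_mul hk hnm hG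
      · have h' : Odd (k + 1 + 1) := by grind
        rw [if_pos h'] at hG ⊢
        rw [if_neg h]
        exact mdeg_shearY_mul hk hnm hG

/-! ### Prime factor count and conclusion -/

theorem le_cardFactors_prod {g : ℕ → ℕ} {k : ℕ} (hg : ∀ i < k, 1 < g i) :
    k ≤ ArithmeticFunction.cardFactors (∏ i ∈ Finset.range k, g i) := by
  induction k with
  | zero => simp
  | succ k ih =>
    have hk := hg k (by lia)
    have h0 : ∏ i ∈ Finset.range k, g i ≠ 0 :=
      Finset.prod_ne_zero_iff.2 fun i hi => by
        have := hg i (by have := Finset.mem_range.1 hi; lia)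
        lia
    rw [Finset.prod_range_succ, ArithmeticFunction.cardFactors_mul h0 (by lia)]
    have := ih fun i hi => hg i (by lia)
    have := ArithmeticFunction.cardFactors_pos_iff_one_lt.2 hk
    lia

/-- The infimum of the empty set is `0`, so a positive length is attained. -/
theorem hasDecomposition_length {F : PolyAut 2} (h : 0 < F.length) :
    F.HasDecomposition F.length :=
  Nat.sInf_mem (Nat.nonempty_of_pos_sInf h)

end PolyAut

open PolyAut in
theorem mainTheorem10 (F : PolyAut 2) (d₁ d₂ : ℕ)
    (hlength : 3 ≤ F.length) (hmdeg : F.mdeg = ![d₁, d₂])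
    (h₁ : 1 < d₁) (h₂ : d₁ < d₂) (hdvd : d₁ ∣ d₂) :
    ∃ a : ℕ, (1 < a ∧ a < d₁ ∧ a ∣ d₁ ∧
        F.length - 2 ≤ ArithmeticFunction.cardFactors (d₁ / a)) ∧
      (F⁻¹.mdeg = ![d₂, d₂ / a] ∨ F⁻¹.mdeg = ![d₂ / a, d₂] ∨ F⁻¹.mdeg = ![d₂, d₂]) := by
  obtain ⟨L₁, L₂, f, hL₁, hL₂, hf, hF⟩ := hasDecomposition_length (F := F) (by lia)
  obtain ⟨s, hs⟩ : ∃ s, F.length = s + 1 + 1 + 1 := ⟨F.length - 3, by lia⟩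
  rw [hs] at hf hF ⊢
  have hpos (i : ℕ) (hi : i < s + 1 + 1 + 1) : 1 < (f (i + 1)).natDegree :=
    hf (i + 1) (by lia) (by lia)
  have hΩ : s + 1 ≤ ArithmeticFunction.cardFactors
      (∏ i ∈ Finset.range (s + 1), (f (i + 2)).natDegree) :=
    le_cardFactors_prod fun i hi => hpos (i + 1) (by lia)
  have hQ : 1 < ∏ i ∈ Finset.range (s + 1), (f (i + 2)).natDegree :=
    ArithmeticFunction.cardFactors_pos_iff_one_lt.1 (by lia)
  have hQ' := Finset.prod_range_succ (fun i => (f (i + 2)).natDegree) (s + 1)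
  have hlast : 1 < (f (s + 1 + 2)).natDegree := hpos (s + 1 + 1) (by lia)
  have hfirst : 1 < (f 1).natDegree := hpos 0 (by lia)
  have hm : _ = (∏ i ∈ Finset.range (s + 1), (f (i + 2)).natDegree) * (f 1).natDegree :=
    Finset.prod_range_succ' (fun i => (f (i + 1)).natDegree) (s + 1)
  have hM : _ = (∏ i ∈ Finset.range (s + 1 + 1), (f (i + 2)).natDegree) * (f 1).natDegree :=
    Finset.prod_range_succ' (fun i => (f (i + 1)).natDegree) (s + 1 + 1)
  have hfwd := mdeg_triangularComp_mul hf hL₁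
  -- Both degrees of `L₂⁻¹` are one, so the parity of the length is immaterial.
  have hbwd := mdeg_inv_triangularComp_mul hf (G := L₂⁻¹) le_rfl
    (by rw [ite_self]; exact mdeg_eq_iff.2 ⟨hL₂.inv 0, hL₂.inv 1⟩)
  rw [one_mul, one_mul] at hbwd
  rw [hM, hm] at hfwd
  rw [hM] at hbwd
  set Q := ∏ i ∈ Finset.range (s + 1), (f (i + 2)).natDegree
  set P := ∏ i ∈ Finset.range (s + 1 + 1), (f (i + 2)).natDegree
  set a := (f 1).natDegree
  have hQP : Q < P := by nlinarith
  have hF' : F⁻¹ = L₁⁻¹ * ((triangularComp f (s + 1 + 1 + 1))⁻¹ * L₂⁻¹) := by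
    rw [hF]; group
  -- Of the three possible multidegrees of `F`, only the increasing one agrees with `d₁ < d₂`.
  have key : d₁ = Q * a ∧ d₂ = P * a := by
    have hlt : Q * a < P * a := Nat.mul_lt_mul_of_pos_right hQP (by lia)
    have h := hL₂.mdeg_mul hlt (by rw [hfwd]; split_ifs <;> simp)
    rw [← mul_assoc, ← hF, hmdeg] at h
    simp only [funext_iff, Fin.forall_fin_two] at h
    simp at h
    lia
  have hinv := hL₁.inv.mdeg_mul (m := P) (M := P * a) (by nlinarith) (Or.inl hbwd)
  rw [← hF', ← key.2] at hinv
  have hd₁ : d₁ / a = Q := by rw [key.1]; exact Nat.mul_div_cancel _ (by lia)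
  have hd₂ : d₂ / a = P := by rw [key.2]; exact Nat.mul_div_cancel _ (by lia)
  refine ⟨a, ⟨hfirst, by rw [key.1]; nlinarith, ⟨Q, by rw [key.1, mul_comm]⟩, ?_⟩, ?_⟩
  · rw [hd₁]
    exact hΩ
  · rw [hd₂]
    tauto
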